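/- **Setting.** A *braided diagram* with finite sets of inputs and outputs (its *ports*) consists of finitely many strands, each primal or dual. A strand is either a closed loop or runs between two *junctions*, the points at which strands of one and the same type are bridged. Along each strand there is a finite ordered list of *braid points*, each shared by exactly one primal and one dual strand, and of ports; every port lies on exactly one strand. Braid points and ports cut a strand into segments. A *correlation surface* assigns a sheet bit $s_e\in\mathbb F_2$ to each strand $e$, a tube bit to each segment, a tube bit $t_v$ to each junction $v$ and a tube bit to each port, such that: (tube–sheet) at a braid point the tube bit of each of the two strands changes by the sheet bit of the other strand, and at a port the tube bit of the strand changes by that of the port; along a closed loop the last segment is the first; (tube–tube) all strand ends at a junction $v$ have tube bit $t_v$; (sheet–sheet) the sheet bits of the strand ends at a junction sum to $0$. At a port on a primal strand the tube bit is the exponent of logical $X$ and the sheet bit that of logical $Z$; on dual strands the roles are exchanged. The *logical correlations* of a diagram are the families of Pauli operators (modulo phases) which its correlation surfaces have at the ports. The *logical computation* of a diagram is the linear map from input qubits to output qubits given by its phase-free ZX diagram: an event (braid point or port) on a primal strand is a red spider and one on a dual strand a green spider, on the two adjacent segments and the wire of the event (so that a braid is a $\mathrm{CNOT}$), and a primal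 junction is a green, a dual junction a red spider. Pauli-frame corrections are ignored and linear maps are considered up to a non-zero scalar. *Unbridging* closes every strand between junctions to a loop of its own, keeping its braid points and ports, and replaces each junction by a ring: a loop of the opposite type which is braided once with each strand end that was attached to the junction. The rings of a set $O$ of junctions may be left out, where $O$ contains at most one junction of each connected bridged structure. A *lattice-surgery circuit* initialises patches in $|+\rangle$ or $|0\rangle$, performs multibody $X\otimes\cdots\otimes X$ and $Z\otimes\cdots\otimes Z$ measurements (merge and split, outcome $+1$), and measures patches out in the $X$ or $Z$ basis. **Proposition.** Let $D$ be any braided diagram, let $O$ be as above and let $D'$ be the diagram obtained from $D$ by unbridging. Then: 1. $D'$ has no junctions and consists of closed loops, so all its connections are tube–sheet connections at braids of loops of opposite type. 2. $D$ and $D'$ perform the same logical computation, up to a non-zero scalar. 3. $D$ and $D'$ have the same logical correlations. 4. Each correlation surface of $D'$ restricts to one of $D$ with the same sheets along the original strands and the same ports, whose tube bit at a junction is the sheet bit of its ring ($0$ for a ring left out), and whose tube bits on the segments of a strand between junctions are those of $D'$ relative to the segment added to close that strand to a loop (on original closed loops they are unchanged). Each correlation surface of $D$ with tube bit $0$ at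 all junctions in $O$ is such a restriction. 5. The following lattice-surgery circuit performs the logical computation of $D$, up to a non-zero scalar: each input and each output has a patch, the output patches being initialised in $|+\rangle$ and the input patches being finally measured in the $X$ basis; each dual loop of $D'$ is an ancilla patch initialised in $|+\rangle$ and measured in the $X$ basis; each primal loop is a $Z\otimes\cdots\otimes Z$ measurement of the patches of the ports on it and of the dual loops with which it is braided an odd number of times; each port on a dual loop is a $Z\otimes Z$ measurement of the patches of the port and of the loop. -/

import Mathlib

/-! Braided surface-code diagrams with bridges, their correlation surfaces, their logical
computation through the ZX calculus, unbridging, and lattice-surgery circuits.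

Measurement outcomes are the `+1` outcomes throughout (the Pauli frame is not tracked), and linear
maps are compared up to a non-zero scalar. Bits live in `ZMod 2`. -/

noncomputable section

open scoped Classical

namespace SurfaceCode

/-- The two types of strands (defects). -/
inductive StrandKind : Type
  | primal
  | dual

/-- The opposite type. -/
def StrandKind.opp : StrandKind → StrandKind
  | .primal => .dual
  | .dual => .primal

theorem StrandKind.opp_opp (k : StrandKind) : k.opp.opp = k := by
  cases k <;> rfl

theorem StrandKind.opp_ne (k : StrandKind) : k.opp ≠ k := by
  cases k <;> simp [StrandKind.opp]

theorem StrandKind.eq_opp_of_ne {j k : StrandKind} (h : j ≠ k) : k = j.opp := by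
  cases j <;> cases k <;> simp_all [StrandKind.opp]

/-- A braided diagram whose inputs and outputs are indexed by `Port`.

A strand is either a closed loop (`ends e = none`) or runs between two junctions of its own type
(`ends e = some (u, v)`); junctions are the points where strands of one type are bridged. Running
along a strand from its start to its end one meets its `events`, in this order: braid points with
strands of the opposite type, and ports, the places at which the logical qubit carried by the strand
is accessed. Every braid point lies on exactly one primal and exactly one dual strand, every port
lies on exactly one strand. -/
structure BraidedDiagram (Port : Type) where
  Strand : Type
  Junction : Type
  Braid : Type
  fintypeStrand : Fintype Strand
  fintypeJunction : Fintype Junction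
  fintypeBraid : Fintype Braid
  kind : Strand → StrandKind
  junctionKind : Junction → StrandKind
  ends : Strand → Option (Junction × Junction)
  ends_kind : ∀ e u v, ends e = some (u, v) → junctionKind u = kind e ∧ junctionKind v = kind e
  /-- the strand of the given type through a braid point -/
  braidStrand : Braid → StrandKind → Strand
  kind_braidStrand : ∀ b k, kind (braidStrand b k) = k
  /-- the strand on which a port lies -/
  portStrand : Port → Strand
  events : Strand → List (Braid ⊕ Port)
  nodup_events : ∀ e, (events e).Nodup
  braid_mem_events : ∀ e b, Sum.inl b ∈ events e ↔ braidStrand b (kind e) = e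
  port_mem_events : ∀ e q, Sum.inr q ∈ events e ↔ portStrand q = e

attribute [instance] BraidedDiagram.fintypeStrand BraidedDiagram.fintypeJunction
  BraidedDiagram.fintypeBraid

namespace BraidedDiagram

variable {Port : Type}

/-- The junction at the start (`false`) or at the end (`true`) of a strand, if there is one. -/
def endpoint (D : BraidedDiagram Port) (e : D.Strand) (b : Bool) : Option D.Junction :=
  (D.ends e).map fun p => if b then p.2 else p.1

/-- The legs of a junction: the strand ends that are attached to it. -/
def legs (D : BraidedDiagram Port) (v : D.Junction) : Finset (D.Strand × Bool) :=
  Finset.univ.filter fun x => D.endpoint x.1 x.2 = some v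

/-- Two junctions belong to the same bridged structure: they are connected by strands. -/
def SameStructure (D : BraidedDiagram Port) : D.Junction → D.Junction → Prop :=
  Relation.EqvGen fun u v => ∃ e, D.ends e = some (u, v)

/-- Nothing is bridged: the diagram consists of independent closed loops, whose only connections
are braids between loops of opposite type. -/
def IsElementary (D : BraidedDiagram Port) : Prop :=
  IsEmpty D.Junction ∧ ∀ e, D.ends e = none

/-! ### Correlation surfaces -/

/-- A candidate for a correlation surface. The strand `e` is cut by its events into
`(D.events e).length + 1` segments; `tube e i` tells whether segment `i` is encircled by a tube.
`sheet e` tells whether a sheet is spanned along `e`. `junctionTube v` tells whether there is a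
tube at the junction `v`, and `portTube q` whether the tube is changed by the logical operator
entering at the port `q`. -/
@[ext]
structure Surface (D : BraidedDiagram Port) where
  sheet : D.Strand → ZMod 2
  tube : (e : D.Strand) → Fin ((D.events e).length + 1) → ZMod 2
  junctionTube : D.Junction → ZMod 2
  portTube : Port → ZMod 2

/-- The change of the tube along the strand `e` at an event: at a braid point the tube is connected
to the sheet of the strand of opposite type; at a port it is connected to the outside. -/
def Surface.jump {D : BraidedDiagram Port} (σ : D.Surface) (e : D.Strand) :
    D.Braid ⊕ Port → ZMod 2
  | .inl b => σ.sheet (D.braidStrand b (D.kind e).opp)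
  | .inr q => σ.portTube q

/-- The rules by which tubes and sheets are connected. -/
structure Surface.IsCorrelationSurface {D : BraidedDiagram Port} (σ : D.Surface) : Prop where
  /-- braids: tubes are connected to sheets of the opposite type (and ports) -/
  tube_sheet : ∀ e (i : Fin (D.events e).length),
    σ.tube e i.succ = σ.tube e i.castSucc + σ.jump e ((D.events e).get i)
  /-- along a closed loop the last segment is the first one -/
  loop : ∀ e, D.ends e = none → σ.tube e (Fin.last _) = σ.tube e 0
  /-- bridges: all the tubes that meet at a junction are connected -/
  tube_tube : ∀ e u v, D.ends e = some (u, v) →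
    σ.tube e 0 = σ.junctionTube u ∧ σ.tube e (Fin.last _) = σ.junctionTube v
  /-- bridges: the sheets that meet at a junction are connected in pairs -/
  sheet_sheet : ∀ v, ∑ x ∈ D.legs v, σ.sheet x.1 = 0

/-- The Pauli operator `X ^ x * Z ^ z`, written `(x, z)`, which a surface has at each port: on primal
strands tubes are logical `X` and sheets logical `Z`, on dual strands it is the other way round. -/
def Surface.logical {D : BraidedDiagram Port} (σ : D.Surface) (q : Port) : ZMod 2 × ZMod 2 :=
  match D.kind (D.portStrand q) with
  | .primal => (σ.portTube q, σ.sheet (D.portStrand q))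
  | .dual => (σ.sheet (D.portStrand q), σ.portTube q)

/-- The correlations between logical operators at the inputs and outputs. -/
def logicalCorrelations (D : BraidedDiagram Port) : Set (Port → ZMod 2 × ZMod 2) :=
  {P | ∃ σ : D.Surface, σ.IsCorrelationSurface ∧ σ.logical = P}

end BraidedDiagram

/-! ### The logical computation -/

/-- `⟨a|0⟩, ⟨a|1⟩`. -/
def zAmp (y a : ZMod 2) : ℂ := if a = y then 1 else 0

/-- `⟨a|+⟩` for `y = 0` and `⟨a|-⟩` for `y = 1`. -/
def xAmp (y a : ZMod 2) : ℂ := (if y = 1 ∧ a = 1 then -1 else 1) / (Real.sqrt 2 : ℂ)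

/-- Matrix entry of the phase-free green spider `|0…0⟩ + |1…1⟩` with legs `ι`. -/
def zSpider {ι : Type} [Fintype ι] (a : ι → ZMod 2) : ℂ := ∑ y : ZMod 2, ∏ i, zAmp y (a i)

/-- Matrix entry of the phase-free red spider `|+…+⟩ + |-…-⟩` with legs `ι`. -/
def xSpider {ι : Type} [Fintype ι] (a : ι → ZMod 2) : ℂ := ∑ y : ZMod 2, ∏ i, xAmp y (a i)

/-- The spider that sits at an event of a strand: red on primal, green on dual strands. So a closed
primal loop is a red spider and a closed dual loop a green one, with one leg for each event, and a
braid, where the two legs are joined, is a `CNOT`. -/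
def eventSpider {ι : Type} [Fintype ι] (k : StrandKind) (a : ι → ZMod 2) : ℂ :=
  match k with
  | .primal => xSpider a
  | .dual => zSpider a

/-- The spider that sits at a junction, of the other colour: it copies tubes and
adds up sheets. -/
def junctionSpider {ι : Type} [Fintype ι] (k : StrandKind) (a : ι → ZMod 2) : ℂ :=
  eventSpider k.opp a

namespace BraidedDiagram

section Interpretation

variable {Port : Type}

/-- The value of the wire at an end of a strand: on its first or its last segment. -/
def endValue (D : BraidedDiagram Port) (w : (e : D.Strand) → Fin ((D.events e).length + 1) → ZMod 2)
    (x : D.Strand × Bool) : ZMod 2 :=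
  w x.1 (if x.2 then Fin.last _ else 0)

/-- The contribution of a labelling of all wires by bits (`w` on the segments of the strands, `β` at
the braid points, `a` at the ports) to the ZX diagram. -/
def weight (D : BraidedDiagram Port) (a : Port → ZMod 2) (β : D.Braid → ZMod 2)
    (w : (e : D.Strand) → Fin ((D.events e).length + 1) → ZMod 2) : ℂ :=
  (∏ e, ∏ i : Fin (D.events e).length,
      eventSpider (D.kind e) ![w e i.castSucc, w e i.succ, Sum.elim β a ((D.events e).get i)]) *
  (∏ e, if D.ends e = none → w e (Fin.last _) = w e 0 then 1 else 0) *
  ∏ v, junctionSpider (D.junctionKind v) fun x : D.legs v => D.endValue w x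

/-- The tensor of the diagram, in the computational basis of the ports. -/
def amplitude (D : BraidedDiagram Port) (a : Port → ZMod 2) : ℂ :=
  ∑ β : D.Braid → ZMod 2, ∑ w : (e : D.Strand) → Fin ((D.events e).length + 1) → ZMod 2,
    D.weight a β w

/-- The linear map from the input qubits to the output qubits which the diagram performs. -/
def computation {In Out : Type} (D : BraidedDiagram (In ⊕ Out)) :
    Matrix (Out → ZMod 2) (In → ZMod 2) ℂ :=
  fun y x => D.amplitude (Sum.elim x y)

end Interpretation

/-! ### Unbridging -/

section Unbridging

variable {Port : Type}

/-- The new braid points: one for each strand end `(e, b)` that is attached to a junction `v` which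
is replaced by a ring. -/
abbrev RingBraid (D : BraidedDiagram Port) (O : Finset D.Junction) : Type :=
  {x : (D.Strand × Bool) × {v : D.Junction // v ∉ O} // D.endpoint x.1.1 x.1.2 = some x.2.1}

/-- The braid points with rings at one end of a strand (at most one). -/
def ringEventsAt (D : BraidedDiagram Port) (O : Finset D.Junction) (e : D.Strand) (b : Bool) :
    List (D.RingBraid O) :=
  (Finset.univ.filter fun r : D.RingBraid O => r.1.1 = (e, b)).toList

/-- The braid points on the ring that replaces the junction `v`. -/
def ringEvents (D : BraidedDiagram Port) (O : Finset D.Junction) (v : {v : D.Junction // v ∉ O}) :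
    List (D.RingBraid O) :=
  (Finset.univ.filter fun r : D.RingBraid O => r.1.2 = v).toList

theorem kind_of_endpoint (D : BraidedDiagram Port) {e : D.Strand} {b : Bool} {v : D.Junction}
    (h : D.endpoint e b = some v) : D.junctionKind v = D.kind e := by
  unfold endpoint at h
  rcases hp : D.ends e with _ | ⟨u, w⟩
  · simp [hp] at h
  · have hk := D.ends_kind e u w hp
    cases b <;> simp [hp] at h <;> subst h
    · exact hk.1
    · exact hk.2

/-- Unbridging. Every strand between two junctions is detached from them and closed to a loop of its
own, which keeps its events. Every junction is replaced by a ring, that is a loop of the opposite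
type, which is braided once with each strand end that was attached to the junction. The set `O`
consists of the junctions whose ring is left out. -/
def unbridge (D : BraidedDiagram Port) (O : Finset D.Junction) : BraidedDiagram Port where
  Strand := D.Strand ⊕ {v : D.Junction // v ∉ O}
  Junction := Empty
  Braid := D.Braid ⊕ D.RingBraid O
  fintypeStrand := inferInstance
  fintypeJunction := inferInstance
  fintypeBraid := inferInstance
  kind := Sum.elim D.kind fun v => (D.junctionKind v.1).opp
  junctionKind := Empty.elim
  ends := fun _ => none
  ends_kind := fun _ _ _ h => by simp at h
  braidStrand := fun b k => match b with
    | .inl b => .inl (D.braidStrand b k)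
    | .inr r => if D.kind r.1.1.1 = k then .inl r.1.1.1 else .inr r.1.2
  kind_braidStrand := by
    rintro (b | r) k
    · exact D.kind_braidStrand b k
    · by_cases h : D.kind r.1.1.1 = k
      · simp [h]
      · have hk := D.kind_of_endpoint r.2
        simp only [if_neg h, Sum.elim_inr, hk]
        exact (StrandKind.eq_opp_of_ne h).symm
  portStrand := fun q => .inl (D.portStrand q)
  events := fun s => match s with
    | .inl e => (D.ringEventsAt O e false).map (Sum.inl ∘ Sum.inr) ++
        ((D.events e).map (Sum.map Sum.inl id) ++
          (D.ringEventsAt O e true).map (Sum.inl ∘ Sum.inr))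
    | .inr v => (D.ringEvents O v).map (Sum.inl ∘ Sum.inr)
  nodup_events := by
    have hinj : Function.Injective
        (Sum.inl ∘ Sum.inr : D.RingBraid O → (D.Braid ⊕ D.RingBraid O) ⊕ Port) :=
      Sum.inl_injective.comp Sum.inr_injective
    rintro (e | v)
    · refine List.Nodup.append ((Finset.nodup_toList _).map hinj) (List.Nodup.append
        ((D.nodup_events e).map (Sum.map_injective.2 ⟨Sum.inl_injective, fun _ _ h => h⟩))
        ((Finset.nodup_toList _).map hinj) ?_) ?_
      · intro x hx hy
        simp only [List.mem_map, Function.comp_apply] at hx hy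
        obtain ⟨a, -, rfl⟩ := hx
        obtain ⟨b, -, hb⟩ := hy
        cases a <;> simp at hb
      · intro x hx hy
        simp only [List.mem_append, List.mem_map, Function.comp_apply] at hx hy
        obtain ⟨a, ha, rfl⟩ := hx
        rcases hy with ⟨b, -, hb⟩ | ⟨b, hb, h⟩
        · cases b <;> simp at hb
        · simp only [Sum.inl.injEq, Sum.inr.injEq] at h
          subst h
          simp only [ringEventsAt, Finset.mem_toList, Finset.mem_filter] at ha hb
          have := ha.2.symm.trans hb.2
          simp at this
    · exact (Finset.nodup_toList _).map hinj
  braid_mem_events := by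
    rintro (e | v) (b | r)
    · simp only [List.mem_append, List.mem_map, Function.comp_apply]
      constructor
      · rintro (⟨a, -, h⟩ | ⟨a, ha, h⟩ | ⟨a, -, h⟩)
        · simp at h
        · cases a <;> simp at h
          subst h
          exact congrArg Sum.inl ((D.braid_mem_events _ _).1 ha)
        · simp at h
      · intro h
        exact Or.inr (Or.inl ⟨_, (D.braid_mem_events e b).2 (Sum.inl_injective h), rfl⟩)
    · simp only [List.mem_append, List.mem_map, Function.comp_apply, Sum.elim_inl]
      constructor
      · rintro (⟨a, ha, h⟩ | ⟨a, ha, h⟩ | ⟨a, ha, h⟩)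
        · simp only [Sum.inl.injEq, Sum.inr.injEq] at h
          subst h
          simp only [ringEventsAt, Finset.mem_toList, Finset.mem_filter] at ha
          simp [ha.2]
        · cases a <;> simp at h
        · simp only [Sum.inl.injEq, Sum.inr.injEq] at h
          subst h
          simp only [ringEventsAt, Finset.mem_toList, Finset.mem_filter] at ha
          simp [ha.2]
      · intro h
        have h1 : r.1.1.1 = e := by
          by_cases hk : D.kind r.1.1.1 = D.kind e
          · simpa [hk] using h
          · simp [hk] at h
        rcases hb : r.1.1.2 with _ | _
        · refine Or.inl ⟨r, ?_, rfl⟩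
          simp only [ringEventsAt, Finset.mem_toList, Finset.mem_filter]
          exact ⟨Finset.mem_univ _, Prod.ext h1 hb⟩
        · refine Or.inr (Or.inr ⟨r, ?_, rfl⟩)
          simp only [ringEventsAt, Finset.mem_toList, Finset.mem_filter]
          exact ⟨Finset.mem_univ _, Prod.ext h1 hb⟩
    · simp
    · have hk := D.kind_of_endpoint r.2
      simp only [List.mem_map, Function.comp_apply, Sum.inl.injEq, Sum.inr.injEq,
        exists_eq_right, ringEvents, Finset.mem_toList, Finset.mem_filter, Finset.mem_univ,
        true_and, Sum.elim_inr]
      constructor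
      · intro h
        subst h
        have hne : D.kind r.1.1.1 ≠ (D.junctionKind r.1.2.1).opp := by
          rw [hk]
          exact (StrandKind.opp_ne _).symm
        exact if_neg hne
      · intro h
        by_cases h' : D.kind r.1.1.1 = (D.junctionKind v.1).opp
        · simp [h'] at h
        · simpa [h'] using h
  port_mem_events := by
    rintro (e | v) q
    · simp only [List.mem_append, List.mem_map, Function.comp_apply]
      constructor
      · rintro (⟨a, -, h⟩ | ⟨a, ha, h⟩ | ⟨a, -, h⟩)
        · simp at h
        · cases a <;> simp at h
          subst h
          exact congrArg Sum.inl ((D.port_mem_events _ _).1 ha)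
        · simp at h
      · intro h
        exact Or.inr (Or.inl ⟨_, (D.port_mem_events e q).2 (Sum.inl_injective h), rfl⟩)
    · simp

theorem segment_lt (D : BraidedDiagram Port) (O : Finset D.Junction) (e : D.Strand)
    (i : Fin ((D.events e).length + 1)) :
    (D.ringEventsAt O e false).length + i.1 < ((D.unbridge O).events (.inl e)).length + 1 := by
  have := i.2
  simp only [unbridge, List.length_append, List.length_map]
  omega

/-- What a surface of the unbridged diagram looks like on the original diagram: the sheets along the
original strands, the tubes around their segments (measured against the segment that was added to
close the strand to a loop), and, as the tube at a junction, the sheet of its ring. -/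
def restrict (D : BraidedDiagram Port) (O : Finset D.Junction) (σ : (D.unbridge O).Surface) :
    D.Surface where
  sheet := fun e => σ.sheet (.inl e)
  tube := fun e i =>
    σ.tube (.inl e) ⟨(D.ringEventsAt O e false).length + i.1, D.segment_lt O e i⟩ +
      if D.ends e = none then 0 else σ.tube (.inl e) 0
  junctionTube := fun v => if h : v ∉ O then σ.sheet (.inr ⟨v, h⟩) else 0
  portTube := σ.portTube

end Unbridging

end BraidedDiagram

/-! ### Lattice surgery -/

/-- The two bases. -/
inductive PauliBasis : Type
  | X
  | Z

/-- Amplitudes of the `+1` eigenstate: `|+⟩` for `X`, `|0⟩` for `Z`. -/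
def PauliBasis.ket : PauliBasis → ZMod 2 → ℂ
  | .X => xAmp 0
  | .Z => zAmp 0

/-- A lattice-surgery circuit. There is a patch for each input, each output, and each element of
`Ancilla`. Output and ancilla patches are initialised in `|+⟩` or `|0⟩`; then multibody measurements
`X ⊗ ⋯ ⊗ X` or `Z ⊗ ⋯ ⊗ Z` are made by merging and splitting, in the order of the list `merges`;
finally input and ancilla patches are measured out in the `X` or the `Z` basis. -/
structure LSCircuit (In Out : Type) where
  Ancilla : Type
  fintypeAncilla : Fintype Ancilla
  init : Out ⊕ Ancilla → PauliBasis
  merges : List (PauliBasis × Finset ((In ⊕ Out) ⊕ Ancilla))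
  final : In ⊕ Ancilla → PauliBasis

attribute [instance] LSCircuit.fintypeAncilla

/-- The projector `(1 + P) / 2`, where `P` is the product of the Pauli operators of the given basis
on the patches in `S`. -/
def mergeProjector {Q : Type} (P : PauliBasis × Finset Q) :
    Matrix (Q → ZMod 2) (Q → ZMod 2) ℂ :=
  match P with
  | (.X, S) => (1 / 2 : ℂ) • (1 + Matrix.of fun b a =>
      if b = a + (fun p => if p ∈ S then 1 else 0) then 1 else 0)
  | (.Z, S) => (1 / 2 : ℂ) • (1 + Matrix.diagonal fun a => if ∑ p ∈ S, a p = 0 then 1 else -1)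

namespace LSCircuit

variable {In Out : Type} [Fintype In] [Fintype Out]

/-- Initialisation, with the inputs in their patches. -/
def initMatrix (L : LSCircuit In Out) :
    Matrix ((In ⊕ Out) ⊕ L.Ancilla → ZMod 2) (In → ZMod 2) ℂ :=
  fun a x => (if ∀ i, a (.inl (.inl i)) = x i then 1 else 0) *
    (∏ o, (L.init (.inl o)).ket (a (.inl (.inr o)))) * ∏ c, (L.init (.inr c)).ket (a (.inr c))

/-- Final measurements, with the outputs left in their patches. -/
def finalMatrix (L : LSCircuit In Out) :
    Matrix (Out → ZMod 2) ((In ⊕ Out) ⊕ L.Ancilla → ZMod 2) ℂ :=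
  fun y a => (if ∀ o, a (.inl (.inr o)) = y o then 1 else 0) *
    (∏ i, (L.final (.inl i)).ket (a (.inl (.inl i)))) * ∏ c, (L.final (.inr c)).ket (a (.inr c))

/-- The linear map which a lattice-surgery circuit performs. -/
def computation (L : LSCircuit In Out) : Matrix (Out → ZMod 2) (In → ZMod 2) ℂ :=
  L.finalMatrix * (L.merges.reverse.map mergeProjector).prod * L.initMatrix

end LSCircuit

namespace BraidedDiagram

variable {In Out : Type} [Fintype In] [Fintype Out]

/-- The patches that the multibody measurement of the primal loop `p` involves: those of the dual
loops with which it is braided (an odd number of times), and those of the ports on it. -/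
def mergeSet (D : BraidedDiagram (In ⊕ Out)) (p : D.Strand) :
    Finset ((In ⊕ Out) ⊕ {e : D.Strand // D.kind e = .dual}) :=
  Finset.univ.filter fun c => match c with
    | .inl q => D.portStrand q = p
    | .inr d => Odd (Finset.univ.filter fun b =>
        D.braidStrand b .primal = p ∧ D.braidStrand b .dual = d.1).card

/-- The patches of a port on a dual loop and of this loop. -/
def portSet (D : BraidedDiagram (In ⊕ Out)) (q : In ⊕ Out) :
    Finset ((In ⊕ Out) ⊕ {e : D.Strand // D.kind e = .dual}) :=
  Finset.univ.filter fun c => match c with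
    | .inl q' => q' = q
    | .inr d => D.portStrand q = d.1

/-- The lattice-surgery circuit of a diagram of loops. A dual loop is an ancilla patch initialised
in `|+⟩` and measured in the `X` basis. A primal loop is a multibody `Z ⊗ ⋯ ⊗ Z` measurement of the
dual loops with which it is braided and of its ports. A port on a dual loop is a `Z ⊗ Z`
measurement with that loop. -/
def toLS (D : BraidedDiagram (In ⊕ Out)) : LSCircuit In Out where
  Ancilla := {e : D.Strand // D.kind e = .dual}
  fintypeAncilla := inferInstance
  init := fun _ => .X
  merges :=
    (Finset.univ.filter fun p => D.kind p = .primal).toList.map (fun p => (.Z, D.mergeSet p)) ++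
    (Finset.univ.filter fun q => D.kind (D.portStrand q) = .dual).toList.map
      (fun q => (.Z, D.portSet q))
  final := fun _ => .X

end BraidedDiagram

end SurfaceCode

end

namespace SurfaceCode

open scoped Classical

/-! Over `ZMod 2` a phase-free spider is a non-zero multiple of the indicator of a linear condition
on its legs: they sum to zero (red) or agree (green). Up to a scalar, the tensor of a diagram
therefore counts the solutions of a linear system with prescribed values at the ports. Non-empty
fibres of such a system are equally large (`exists_card_fiber`), so the tensor is a constant times
the indicator of the port values that extend to a solution. A solution amounts to the primal tubes
and dual sheets of a correlation surface, and its port values are the exponents of `X`. Hence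
`amplitude_eq`: the logical correlations determine the computation up to a scalar, and it suffices
to preserve the correlations.

For these, a tube is its initial value plus partial sums of its jumps. Once a strand between
junctions is closed to a loop, the rings at its ends supply the jumps between the added segment and
the junction tubes, so the closing condition of the loop is the tube-tube rule. The closing
condition of a ring is the sheet-sheet rule at its junction. A left-out ring costs nothing: its
sheet condition follows from the others of the same bridged structure, because every strand has two
ends (`sum_legs_eq_zero`), and its tube can be cleared by adding a tube around the whole structure
(`exists_junctionTube_eq_zero`).

In the circuit, the `Z` measurements are diagonal projectors, while preparations and measurements in
the `X` basis have constant amplitudes. Its matrix thus again counts solutions: ancilla bits are the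
sheets of dual loops, and the measurements impose the closing conditions of primal loops and the
values at dual ports. This gives the same indicator (`IsElementary.toLS_computation`). -/

/-! ### Counting solutions of additive relations. -/

/-- The non-empty fibres of an additive relation between elementary abelian 2-groups all have the
same number of elements. -/
theorem exists_card_fiber {A B : Type} [AddCommGroup A] [AddCommGroup B] [Fintype B]
    (S : A → B → Prop) (hA : ∀ a : A, a + a = 0) (h0 : S 0 0)
    (hadd : ∀ a b a' b', S a b → S a' b' → S (a + a') (b + b')) :
    ∃ n : ℕ, n ≠ 0 ∧ ∀ a, (Finset.univ.filter (S a)).card = if ∃ b, S a b then n else 0 := by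
  refine ⟨(Finset.univ.filter (S 0)).card, ?_, fun a => ?_⟩
  · exact (Finset.card_pos.2 ⟨0, by simpa using h0⟩).ne'
  · split_ifs with h
    · obtain ⟨b, hb⟩ := h
      -- Translation by `b` maps the fibre over `a` into the fibre over `0`, since `a + a = 0`, and
      -- vice versa.
      apply le_antisymm
      · refine Finset.card_le_card_of_injOn (· + b) (fun x hx => ?_)
          (fun _ _ _ _ h => add_right_cancel h)
        have := hadd _ _ _ _ (by simpa using hx) hb
        rw [hA] at this
        simpa using this
      · refine Finset.card_le_card_of_injOn (· + b) (fun x hx => ?_)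
          (fun _ _ _ _ h => add_right_cancel h)
        have := hadd _ _ _ _ (by simpa using hx) hb
        rw [zero_add] at this
        simpa using this
    · push Not at h
      simp [h]

theorem sum_indicator_fiber {A B : Type} [AddCommGroup A] [AddCommGroup B] [Fintype B]
    (S : A → B → Prop) (hA : ∀ a : A, a + a = 0) (h0 : S 0 0)
    (hadd : ∀ a b a' b', S a b → S a' b' → S (a + a') (b + b')) :
    ∃ c : ℂ, c ≠ 0 ∧ ∀ a, (∑ b, if S a b then (1 : ℂ) else 0) = if ∃ b, S a b then c else 0 := by
  obtain ⟨n, hn, h⟩ := exists_card_fiber S hA h0 hadd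
  refine ⟨n, by exact_mod_cast hn, fun a => ?_⟩
  rw [Finset.sum_boole, h]
  split_ifs <;> simp

theorem ZMod.two_cases (x : ZMod 2) : x = 0 ∨ x = 1 := by
  revert x; decide

theorem mul_indicators (c d : ℂ) (p₁ p₂ p₃ : Prop) [Decidable p₁] [Decidable p₂] [Decidable p₃]
    [Decidable (p₁ ∧ p₂ ∧ p₃)] :
    (c * if p₁ then 1 else 0) * (if p₂ then 1 else 0) * (d * if p₃ then 1 else 0) =
      c * d * if p₁ ∧ p₂ ∧ p₃ then 1 else 0 := by
  by_cases h₁ : p₁ <;> by_cases h₂ : p₂ <;> by_cases h₃ : p₃ <;> simp [h₁, h₂, h₃]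

/-! ### Supports of spiders -/

/-- The support of a spider: on primal strands the legs add up to zero, on dual strands they
agree. -/
def SpiderRule {ι : Type} [Fintype ι] : StrandKind → (ι → ZMod 2) → Prop
  | .primal, a => ∑ i, a i = 0
  | .dual, a => ∃ t, ∀ i, a i = t

theorem SpiderRule.zero {ι : Type} [Fintype ι] (k : StrandKind) :
    SpiderRule k (0 : ι → ZMod 2) := by
  cases k
  · simp [SpiderRule]
  · exact ⟨0, fun _ => rfl⟩

theorem SpiderRule.add {ι : Type} [Fintype ι] {k : StrandKind} {a b : ι → ZMod 2}
    (ha : SpiderRule k a) (hb : SpiderRule k b) : SpiderRule k (a + b) := by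
  cases k
  · simp only [SpiderRule] at *
    simp [Finset.sum_add_distrib, ha, hb]
  · obtain ⟨s, hs⟩ := ha
    obtain ⟨t, ht⟩ := hb
    exact ⟨s + t, fun i => by simp [hs, ht]⟩

theorem sum_zmod_two {M : Type} [AddCommMonoid M] (f : ZMod 2 → M) : ∑ y, f y = f 0 + f 1 :=
  Fin.sum_univ_two f

theorem prod_sign {ι : Type} (s : Finset ι) (a : ι → ZMod 2) :
    (∏ i ∈ s, if a i = 1 then (-1 : ℂ) else 1) = if ∑ i ∈ s, a i = 0 then 1 else -1 := by
  induction s using Finset.induction_on with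
  | empty => simp
  | insert i s hi ih =>
    rw [Finset.prod_insert hi, Finset.sum_insert hi, ih]
    rcases ZMod.two_cases (a i) with h | h <;>
    rcases ZMod.two_cases (∑ i ∈ s, a i) with h' | h' <;>
    simp [h, h', show (1 + 1 : ZMod 2) = 0 from rfl]

/-- The two summands are `1` and the sign of the leg sum, times one factor `1 / √2` per leg; they
add up to `2` or cancel. -/
theorem xSpider_eq {ι : Type} [Fintype ι] :
    ∃ c : ℂ, c ≠ 0 ∧ ∀ a : ι → ZMod 2, xSpider a = c * if ∑ i, a i = 0 then 1 else 0 := by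
  refine ⟨2 * (1 / (Real.sqrt 2 : ℂ)) ^ Fintype.card ι, ?_, fun a => ?_⟩
  · simp
  · have h : ∀ y i, xAmp y (a i) =
        (if y = 1 ∧ a i = 1 then -1 else 1) * (1 / (Real.sqrt 2 : ℂ)) := fun y i => by
      rw [xAmp, mul_one_div]
    simp only [xSpider, h, Finset.prod_mul_distrib, sum_zmod_two, Finset.prod_const]
    simp only [zero_ne_one, false_and, if_false, true_and, prod_sign, Finset.prod_const_one]
    rw [← add_mul, Finset.card_univ]
    split_ifs <;> ring

theorem zSpider_eq {ι : Type} [Fintype ι] :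
    ∃ c : ℂ, c ≠ 0 ∧ ∀ a : ι → ZMod 2, zSpider a = c * if ∃ t, ∀ i, a i = t then 1 else 0 := by
  have h : ∀ a : ι → ZMod 2, zSpider a = ∑ y, if ∀ i, a i = y then 1 else 0 := fun a => by
    simp [zSpider, zAmp, Finset.prod_boole]
  -- Without legs both values of `y` contribute, so the constant is `2`; with a leg the common value
  -- is unique.
  rcases isEmpty_or_nonempty ι with hι | ⟨⟨i₀⟩⟩
  · refine ⟨2, two_ne_zero, fun a => ?_⟩
    rw [h]
    simp
  · refine ⟨1, one_ne_zero, fun a => ?_⟩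
    rw [h, one_mul]
    split_ifs with ht
    · obtain ⟨t, ht⟩ := ht
      have : ∀ y, (∀ i, a i = y) ↔ y = t :=
        fun y => ⟨fun hy => (hy i₀).symm.trans (ht i₀), fun hy i => (ht i).trans hy.symm⟩
      simp [this]
    · push Not at ht
      refine Finset.sum_eq_zero fun y _ => if_neg ?_
      push Not
      exact ht y

theorem eventSpider_eq {ι : Type} [Fintype ι] (k : StrandKind) :
    ∃ c : ℂ, c ≠ 0 ∧ ∀ a : ι → ZMod 2,
      eventSpider k a = c * if SpiderRule k a then 1 else 0 := by
  cases k
  · obtain ⟨c, hc, h⟩ := xSpider_eq (ι := ι)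
    exact ⟨c, hc, fun a => (h a).trans (by congr)⟩
  · obtain ⟨c, hc, h⟩ := zSpider_eq (ι := ι)
    exact ⟨c, hc, fun a => (h a).trans (by congr)⟩

/-! ### Wire labellings and the exponents of `X`. -/

namespace BraidedDiagram

variable {Port : Type}

/-- The labellings of the wires that contribute to the amplitude. -/
structure IsLabelling (D : BraidedDiagram Port) (a : Port → ZMod 2) (β : D.Braid → ZMod 2)
    (w : (e : D.Strand) → Fin ((D.events e).length + 1) → ZMod 2) : Prop where
  event : ∀ e (i : Fin (D.events e).length), SpiderRule (D.kind e)
    ![w e i.castSucc, w e i.succ, Sum.elim β a ((D.events e).get i)]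
  loop : ∀ e, D.ends e = none → w e (Fin.last _) = w e 0
  junction : ∀ v, SpiderRule (D.junctionKind v).opp fun x : D.legs v => D.endValue w x

theorem IsLabelling.zero (D : BraidedDiagram Port) : D.IsLabelling 0 0 0 where
  event e i := by
    convert SpiderRule.zero (ι := Fin 3) (D.kind e) using 1
    ext j
    rcases h : (D.events e).get i with b | q <;> fin_cases j <;> simp
  loop _ _ := rfl
  junction _ := SpiderRule.zero _

theorem IsLabelling.add {D : BraidedDiagram Port} {a a' β β' w w'} (h : D.IsLabelling a β w)
    (h' : D.IsLabelling a' β' w') : D.IsLabelling (a + a') (β + β') (w + w') where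
  event e i := by
    convert (h.event e i).add (h'.event e i) using 1
    ext j
    rcases h : (D.events e).get i with b | q <;> fin_cases j <;> simp
  loop e he := by simp [h.loop e he, h'.loop e he]
  junction v := (h.junction v).add (h'.junction v)

theorem weight_eq (D : BraidedDiagram Port) :
    ∃ c : ℂ, c ≠ 0 ∧ ∀ a β w, D.weight a β w = c * if D.IsLabelling a β w then 1 else 0 := by
  choose ce hce he using fun k => eventSpider_eq (ι := Fin 3) k
  choose cj hcj hj using fun v : D.Junction =>
    eventSpider_eq (ι := D.legs v) (D.junctionKind v).opp
  refine ⟨(∏ e, ∏ _i : Fin (D.events e).length, ce (D.kind e)) * ∏ v, cj v,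
    mul_ne_zero (Finset.prod_ne_zero_iff.2 fun e _ => Finset.prod_ne_zero_iff.2 fun _ _ => hce _)
      (Finset.prod_ne_zero_iff.2 fun v _ => hcj v), fun a β w => ?_⟩
  have hiff : D.IsLabelling a β w ↔ (∀ e (i : Fin (D.events e).length), SpiderRule (D.kind e)
      ![w e i.castSucc, w e i.succ, Sum.elim β a ((D.events e).get i)]) ∧
      (∀ e, D.ends e = none → w e (Fin.last _) = w e 0) ∧
      ∀ v, SpiderRule (D.junctionKind v).opp fun x : D.legs v => D.endValue w x :=
    ⟨fun h => ⟨h.event, h.loop, h.junction⟩, fun h => ⟨h.1, h.2.1, h.2.2⟩⟩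
  simp only [weight, junctionSpider, he, hj, Finset.prod_mul_distrib, Finset.prod_boole,
    Finset.mem_univ, true_imp_iff, hiff]
  exact mul_indicators _ _ _ _ _

/-- The exponents of `X` in the logical correlations. -/
def xCorrelations (D : BraidedDiagram Port) : Set (Port → ZMod 2) :=
  (fun P q => (P q).1) '' D.logicalCorrelations

theorem mem_xCorrelations {D : BraidedDiagram Port} {a : Port → ZMod 2} :
    a ∈ D.xCorrelations ↔ ∃ σ : D.Surface, σ.IsCorrelationSurface ∧ ∀ q, (σ.logical q).1 = a q := by
  constructor
  · rintro ⟨_, ⟨σ, hσ, rfl⟩, rfl⟩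
    exact ⟨σ, hσ, fun _ => rfl⟩
  · rintro ⟨σ, hσ, h⟩
    exact ⟨_, ⟨σ, hσ, rfl⟩, funext h⟩

theorem portStrand_of_get {D : BraidedDiagram Port} {e : D.Strand} {i : Fin (D.events e).length}
    {q : Port} (h : (D.events e).get i = .inr q) : D.portStrand q = e :=
  (D.port_mem_events e q).1 (h ▸ List.get_mem _ _)

theorem Surface.logical_fst_of_primal {D : BraidedDiagram Port} (σ : D.Surface) {q : Port}
    (h : D.kind (D.portStrand q) = .primal) : (σ.logical q).1 = σ.portTube q := by
  simp [Surface.logical, h]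

theorem Surface.logical_fst_of_dual {D : BraidedDiagram Port} (σ : D.Surface) {q : Port}
    (h : D.kind (D.portStrand q) = .dual) : (σ.logical q).1 = σ.sheet (D.portStrand q) := by
  simp [Surface.logical, h]

theorem kind_of_mem_legs {D : BraidedDiagram Port} {v : D.Junction} {x : D.Strand × Bool}
    (h : x ∈ D.legs v) : D.kind x.1 = D.junctionKind v :=
  (D.kind_of_endpoint (Finset.mem_filter.1 h).2).symm

/-- The labelling of the wires to which a correlation surface gives rise. -/
theorem Surface.IsCorrelationSurface.isLabelling {D : BraidedDiagram Port} {σ : D.Surface}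
    (hσ : σ.IsCorrelationSurface) :
    D.IsLabelling (fun q => (σ.logical q).1) (fun b => σ.sheet (D.braidStrand b .dual))
      (fun e i => if D.kind e = .primal then σ.tube e i else σ.sheet e) where
  event e i := by
    have ht := hσ.tube_sheet e i
    rcases hk : D.kind e with _ | _
    · have hj : Sum.elim (fun b => σ.sheet (D.braidStrand b .dual)) (fun q => (σ.logical q).1)
          ((D.events e).get i) = σ.jump e ((D.events e).get i) := by
        rcases h : (D.events e).get i with b | q
        · simp [Surface.jump, hk, StrandKind.opp]
        · exact σ.logical_fst_of_primal (portStrand_of_get h ▸ hk)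
      simp only [SpiderRule, hj, Fin.sum_univ_three, if_true]
      simp only [Matrix.cons_val, ht]
      -- The red spider rule is the tube-sheet rule with all terms on one side, in characteristic 2.
      linear_combination CharTwo.add_self_eq_zero (σ.tube e i.castSucc) +
        CharTwo.add_self_eq_zero (σ.jump e ((D.events e).get i))
    · refine ⟨σ.sheet e, fun j => ?_⟩
      fin_cases j
      · simp
      · simp
      · rcases h : (D.events e).get i with b | q
        · have : D.braidStrand b .dual = e :=
            hk ▸ (D.braid_mem_events e b).1 (h ▸ List.get_mem _ _)
          simp [this]
        · have := portStrand_of_get h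
          simp [σ.logical_fst_of_dual (q := q) (by rw [this]; exact hk), this]
  loop e he := by simp [hσ.loop e he]
  junction v := by
    have hl : ∀ x : D.legs v, D.kind x.1.1 = D.junctionKind v := fun x => kind_of_mem_legs x.2
    simp only [endValue, hl]
    rcases hk : D.junctionKind v with _ | _
    -- A primal junction is green, so tubes must agree; at a dual junction, below, the spider is red
    -- and sheets must sum to zero.
    · refine ⟨σ.junctionTube v, ?_⟩
      rintro ⟨⟨e, b⟩, hx⟩
      have hx := (Finset.mem_filter.1 hx).2
      simp only [endpoint, Option.map_eq_some_iff] at hx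
      obtain ⟨⟨u, u'⟩, h, h'⟩ := hx
      have := hσ.tube_tube e u u' h
      cases b <;> simp at h' <;> subst h'
      · simpa using this.1
      · simpa using this.2
    · simpa [SpiderRule, StrandKind.opp] using
        (Finset.sum_coe_sort (D.legs v) fun x => σ.sheet x.1).trans (hσ.sheet_sheet v)

/-- The events on a dual strand are green spiders, which propagate one bit along the whole strand.
-/
theorem IsLabelling.tube_const {D : BraidedDiagram Port} {a β w} (h : D.IsLabelling a β w)
    {e : D.Strand} (hk : D.kind e = .dual) (i : Fin ((D.events e).length + 1)) :
    w e i = w e 0 := by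
  induction i using Fin.induction with
  | zero => rfl
  | succ i ih =>
    have := h.event e i
    rw [hk] at this
    obtain ⟨t, ht⟩ := this
    have h0 := ht 0
    have h1 := ht 1
    simp only [Matrix.cons_val] at h0 h1
    rw [h1, ← h0, ih]

theorem IsLabelling.event_eq {D : BraidedDiagram Port} {a β w} (h : D.IsLabelling a β w)
    {e : D.Strand} (hk : D.kind e = .dual) {x : D.Braid ⊕ Port} (hx : x ∈ D.events e) :
    Sum.elim β a x = w e 0 := by
  obtain ⟨i, rfl⟩ := List.get_of_mem hx
  have := h.event e i
  rw [hk] at this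
  obtain ⟨t, ht⟩ := this
  have h0 := ht 0
  have h2 := ht 2
  simp only [Matrix.cons_val] at h0 h2
  rw [h2, ← h0, h.tube_const hk]

/-- A labelling does not see primal sheets and dual tubes. Setting all of these to zero is
consistent, because the tube and sheet rules never couple them to primal tubes and dual sheets. -/
theorem IsLabelling.mem_xCorrelations {D : BraidedDiagram Port} {a β w}
    (h : D.IsLabelling a β w) : a ∈ D.xCorrelations := by
  have hv : ∀ v, ∃ t, D.junctionKind v = .primal → ∀ x : D.legs v, D.endValue w x = t := by
    intro v
    rcases hk : D.junctionKind v with _ | _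
    · have := h.junction v
      rw [hk] at this
      obtain ⟨t, ht⟩ := this
      exact ⟨t, fun _ => ht⟩
    · exact ⟨0, fun h => by simp at h⟩
  choose t ht using hv
  let σ : D.Surface :=
    { sheet := fun e => if D.kind e = .primal then 0 else w e 0
      tube := fun e i => if D.kind e = .primal then w e i else 0
      junctionTube := fun v => if D.junctionKind v = .primal then t v else 0
      portTube := fun q => if D.kind (D.portStrand q) = .primal then a q else 0 }
  refine BraidedDiagram.mem_xCorrelations.2 ⟨σ, ⟨fun e i => ?_, fun e he => ?_, fun e u v he => ?_,
    fun v => ?_⟩, fun q => ?_⟩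
  · rcases hk : D.kind e with _ | _
    · have hj : σ.jump e ((D.events e).get i) = Sum.elim β a ((D.events e).get i) := by
        rcases hx : (D.events e).get i with b | q
        -- The wire of the braid carries the constant bit of its dual strand, which is the sheet
        -- that the primal tube meets.
        · have hd := D.kind_braidStrand b .dual
          have := h.event_eq hd ((D.braid_mem_events (D.braidStrand b .dual) b).2 (by rw [hd]))
          simp only [Sum.elim_inl] at this
          rw [Sum.elim_inl, this, Surface.jump, hk]
          simp [σ, StrandKind.opp, hd]
          rfl
        · simp [σ, Surface.jump, portStrand_of_get hx, hk]
      have he := h.event e i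
      rw [hk] at he
      simp only [SpiderRule, Fin.sum_univ_three] at he
      simp only [Matrix.cons_val] at he
      rw [hj]
      simp only [σ, hk, if_true]
      linear_combination he - CharTwo.add_self_eq_zero (w e i.castSucc) -
        CharTwo.add_self_eq_zero (Sum.elim β a ((D.events e).get i))
    · have hj : σ.jump e ((D.events e).get i) = 0 := by
        rcases hx : (D.events e).get i with b | q
        · simp [σ, Surface.jump, hk, StrandKind.opp, D.kind_braidStrand]
        · simp [σ, Surface.jump, portStrand_of_get hx, hk]
      rw [hj]
      simp [σ, hk]
  · simp [σ, h.loop e he]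
  · have hk := D.ends_kind e u v he
    rcases hk' : D.kind e with _ | _
    · have h1 : (e, false) ∈ D.legs u := by simp [legs, endpoint, he]
      have h2 : (e, true) ∈ D.legs v := by simp [legs, endpoint, he]
      have h3 := ht u (hk.1.trans hk') ⟨_, h1⟩
      have h4 := ht v (hk.2.trans hk') ⟨_, h2⟩
      simp only [endValue] at h3 h4
      constructor
      · simpa [σ, hk, hk'] using h3
      · simpa [σ, hk, hk'] using h4
    · simp [σ, hk, hk']
  · rcases hk : D.junctionKind v with _ | _
    · exact Finset.sum_eq_zero fun x hx => by simp [σ, kind_of_mem_legs hx, hk]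
    · have hj := h.junction v
      rw [hk] at hj
      simp only [StrandKind.opp, SpiderRule] at hj
      rw [Finset.sum_coe_sort (D.legs v) fun x => D.endValue w x] at hj
      rw [← hj]
      refine Finset.sum_congr rfl fun x hx => ?_
      have := (kind_of_mem_legs hx).trans hk
      simp only [σ, this, endValue, h.tube_const this]
      simp
  · rcases hk : D.kind (D.portStrand q) with _ | _
    · rw [σ.logical_fst_of_primal hk]
      simp [σ, hk]
    · rw [σ.logical_fst_of_dual hk]
      have := h.event_eq hk ((D.port_mem_events _ q).2 rfl)
      simp only [Sum.elim_inr] at this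
      simp [σ, hk, this]

theorem exists_isLabelling_iff {D : BraidedDiagram Port} {a : Port → ZMod 2} :
    (∃ x : (D.Braid → ZMod 2) × ((e : D.Strand) → Fin ((D.events e).length + 1) → ZMod 2),
      D.IsLabelling a x.1 x.2) ↔ a ∈ D.xCorrelations := by
  constructor
  · rintro ⟨x, hx⟩
    exact hx.mem_xCorrelations
  · rintro ⟨_, ⟨σ, hσ, rfl⟩, rfl⟩
    exact ⟨⟨_, _⟩, hσ.isLabelling⟩

/-- The tensor of a diagram is, up to a scalar, the indicator function of the exponents of `X` in
its logical correlations. -/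
theorem amplitude_eq (D : BraidedDiagram Port) :
    ∃ c : ℂ, c ≠ 0 ∧ ∀ a, D.amplitude a = if a ∈ D.xCorrelations then c else 0 := by
  obtain ⟨c₁, hc₁, h₁⟩ := D.weight_eq
  obtain ⟨c₂, hc₂, h₂⟩ := sum_indicator_fiber
    -- Labellings form an additive relation between the port values and the bits on the inner wires.
    (fun a (x : (D.Braid → ZMod 2) × ((e : D.Strand) → Fin ((D.events e).length + 1) → ZMod 2)) =>
      D.IsLabelling a x.1 x.2) (fun a => funext fun q => CharTwo.add_self_eq_zero (a q))
    (IsLabelling.zero D) (fun _ _ _ _ h h' => h.add h')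
  refine ⟨c₁ * c₂, mul_ne_zero hc₁ hc₂, fun a => ?_⟩
  have := h₂ a
  rw [Fintype.sum_prod_type] at this
  simp only [amplitude, h₁, ← Finset.mul_sum, this, exists_isLabelling_iff]
  rw [mul_ite, mul_zero]

end BraidedDiagram
namespace BraidedDiagram

variable {Port : Type}

/-! ### Tubes as partial sums -/

/-- The total change of the tube along a list of events of the strand `e`. -/
def Surface.jumpSum {D : BraidedDiagram Port} (σ : D.Surface) (e : D.Strand)
    (l : List (D.Braid ⊕ Port)) : ZMod 2 :=
  (l.map (σ.jump e)).sum

@[simp]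
theorem Surface.jumpSum_nil {D : BraidedDiagram Port} (σ : D.Surface) (e : D.Strand) :
    σ.jumpSum e [] = 0 :=
  rfl

theorem Surface.jumpSum_append {D : BraidedDiagram Port} (σ : D.Surface) (e : D.Strand)
    (l l' : List (D.Braid ⊕ Port)) :
    σ.jumpSum e (l ++ l') = σ.jumpSum e l + σ.jumpSum e l' := by
  simp [jumpSum]

theorem Surface.jumpSum_map {D : BraidedDiagram Port} (σ : D.Surface) (e : D.Strand) {A : Type}
    (f : A → D.Braid ⊕ Port) (l : List A) :
    σ.jumpSum e (l.map f) = (l.map fun x => σ.jump e (f x)).sum := by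
  rw [jumpSum, List.map_map]
  rfl

theorem Surface.jumpSum_take_succ {D : BraidedDiagram Port} (σ : D.Surface) (e : D.Strand)
    (i : Fin (D.events e).length) :
    σ.jumpSum e ((D.events e).take (i + 1)) =
      σ.jumpSum e ((D.events e).take i) + σ.jump e ((D.events e).get i) := by
  rw [List.take_add_one]
  simp [Surface.jumpSum]

/-- Integrating the tube-sheet rule leaves one free bit per strand, so that only conditions on total
jumps remain. -/
theorem Surface.IsCorrelationSurface.tube_eq {D : BraidedDiagram Port} {σ : D.Surface}
    (hσ : σ.IsCorrelationSurface) (e : D.Strand) (i : Fin ((D.events e).length + 1)) :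
    σ.tube e i = σ.tube e 0 + σ.jumpSum e ((D.events e).take i) := by
  induction i using Fin.induction with
  | zero => simp
  | succ i ih =>
    rw [hσ.tube_sheet, ih, Fin.val_succ, σ.jumpSum_take_succ, Fin.val_castSucc, add_assoc]

theorem Surface.IsCorrelationSurface.jumpSum_loop {D : BraidedDiagram Port} {σ : D.Surface}
    (hσ : σ.IsCorrelationSurface) {e : D.Strand} (he : D.ends e = none) :
    σ.jumpSum e (D.events e) = 0 := by
  have h := hσ.loop e he
  rw [hσ.tube_eq] at h
  simpa using h

theorem Surface.tube_sheet_of_tube_eq {D : BraidedDiagram Port} {σ : D.Surface} {e : D.Strand}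
    {c : ZMod 2} (h : ∀ i, σ.tube e i = c + σ.jumpSum e ((D.events e).take i))
    (i : Fin (D.events e).length) :
    σ.tube e i.succ = σ.tube e i.castSucc + σ.jump e ((D.events e).get i) := by
  rw [h, h, Fin.val_succ, σ.jumpSum_take_succ, Fin.val_castSucc, add_assoc]

/-- The surface with given sheets, tubes at the starts of strands, and tubes at junctions and ports,
whose tubes follow the sheets. -/
def Surface.ofStart (D : BraidedDiagram Port) (sheet start : D.Strand → ZMod 2)
    (junctionTube : D.Junction → ZMod 2) (portTube : Port → ZMod 2) : D.Surface where
  sheet := sheet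
  tube e i := start e + Surface.jumpSum ⟨sheet, 0, junctionTube, portTube⟩ e ((D.events e).take i)
  junctionTube := junctionTube
  portTube := portTube

theorem Surface.jump_congr {D : BraidedDiagram Port} {σ τ : D.Surface} (hs : σ.sheet = τ.sheet)
    (hp : σ.portTube = τ.portTube) : σ.jump = τ.jump := by
  ext e (b | q) <;> simp [Surface.jump, hs, hp]

/-! ### Restriction to the original diagram -/

variable {D : BraidedDiagram Port} {O : Finset D.Junction}

/-- The loop to which a strand is closed. -/
def loopOf (O : Finset D.Junction) (e : D.Strand) : (D.unbridge O).Strand :=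
  Sum.inl e

/-- The ring that replaces a junction. -/
def ringOf (v : {v : D.Junction // v ∉ O}) : (D.unbridge O).Strand :=
  Sum.inr v

/-- The original events in the unbridged diagram. -/
def keptEvent (O : Finset D.Junction) : D.Braid ⊕ Port → (D.unbridge O).Braid ⊕ Port :=
  Sum.map Sum.inl id

/-- The braid points with rings as events of the unbridged diagram. -/
def ringEvent (r : D.RingBraid O) : (D.unbridge O).Braid ⊕ Port :=
  Sum.inl (Sum.inr r)

theorem unbridge_events_loopOf (e : D.Strand) : (D.unbridge O).events (loopOf O e) =
    (D.ringEventsAt O e false).map ringEvent ++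
      ((D.events e).map (keptEvent O) ++ (D.ringEventsAt O e true).map ringEvent) :=
  rfl

theorem unbridge_events_ringOf (v : {v : D.Junction // v ∉ O}) :
    (D.unbridge O).events (ringOf v) = (D.ringEvents O v).map ringEvent :=
  rfl

theorem restrict_jump (τ : (D.unbridge O).Surface) (e : D.Strand) (x : D.Braid ⊕ Port) :
    (D.restrict O τ).jump e x = τ.jump (loopOf O e) (keptEvent O x) := by
  cases x <;> rfl

theorem restrict_jumpSum (τ : (D.unbridge O).Surface) (e : D.Strand) (l : List (D.Braid ⊕ Port)) :
    (D.restrict O τ).jumpSum e l = τ.jumpSum (loopOf O e) (l.map (keptEvent O)) := by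
  rw [Surface.jumpSum_map, Surface.jumpSum]
  exact congrArg List.sum (List.map_congr_left fun x _ => restrict_jump τ e x)

/-- At the end of a strand the tube changes by the sheet of the ring that replaces the junction. -/
theorem jumpSum_ringEventsAt (τ : (D.unbridge O).Surface) (e : D.Strand) (b : Bool) :
    τ.jumpSum (loopOf O e) ((D.ringEventsAt O e b).map ringEvent) =
      (D.endpoint e b).elim 0 (D.restrict O τ).junctionTube := by
  have hjump : ∀ r : D.RingBraid O, r.1.1 = (e, b) →
      τ.jump (loopOf O e) (ringEvent r) = τ.sheet (ringOf r.1.2) := fun r hr => by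
    -- The strand of type opposite to `e` through a ring braid is the ring, the second branch of
    -- `braidStrand`.
    have hk : ¬ D.kind r.1.1.1 = (D.kind e).opp := by
      rw [hr]
      exact (StrandKind.opp_ne _).symm
    exact congrArg τ.sheet (if_neg hk)
  rw [Surface.jumpSum_map, ringEventsAt, Finset.sum_map_toList]
  rcases h : D.endpoint e b with _ | v
  · rw [Finset.filter_eq_empty_iff.2, Finset.sum_empty]
    · rfl
    · rintro r - hr
      have := r.2
      rw [hr, h] at this
      simp at this
  · by_cases hv : v ∉ O
    · have : (Finset.univ.filter fun r : D.RingBraid O => r.1.1 = (e, b)) =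
          {⟨((e, b), ⟨v, hv⟩), h⟩} := by
        ext r
        simp only [Finset.mem_filter, Finset.mem_univ, true_and, Finset.mem_singleton]
        constructor
        · intro hr
          have h2 := r.2
          rw [hr, h] at h2
          exact Subtype.ext (Prod.ext hr (Subtype.ext (Option.some_injective _ h2).symm))
        · rintro rfl
          rfl
      rw [this, Finset.sum_singleton]
      rw [hjump _ rfl]
      simp only [restrict, Option.elim_some, dif_pos hv]
      rfl
    · rw [Finset.filter_eq_empty_iff.2, Finset.sum_empty]
      · simp [restrict, hv]
      · rintro r - hr
        have := r.2
        rw [hr, h] at this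
        exact hv (Option.some_injective _ this ▸ r.1.2.2)

theorem jumpSum_unbridge (τ : (D.unbridge O).Surface) (e : D.Strand) :
    τ.jumpSum (loopOf O e) ((D.unbridge O).events (loopOf O e)) =
      (D.endpoint e false).elim 0 (D.restrict O τ).junctionTube +
        (D.restrict O τ).jumpSum e (D.events e) +
          (D.endpoint e true).elim 0 (D.restrict O τ).junctionTube := by
  rw [← jumpSum_ringEventsAt, ← jumpSum_ringEventsAt, restrict_jumpSum, unbridge_events_loopOf]
  simp only [Surface.jumpSum_append, add_assoc]

theorem jumpSum_unbridge_take (τ : (D.unbridge O).Surface) (e : D.Strand)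
    (i : Fin ((D.events e).length + 1)) :
    τ.jumpSum (loopOf O e) (((D.unbridge O).events (loopOf O e)).take
        ((D.ringEventsAt O e false).length + i)) =
      (D.endpoint e false).elim 0 (D.restrict O τ).junctionTube +
        (D.restrict O τ).jumpSum e ((D.events e).take i) := by
  rw [← jumpSum_ringEventsAt, restrict_jumpSum, unbridge_events_loopOf]
  have hi : (i : ℕ) ≤ ((D.events e).map (keptEvent O)).length := by
    rw [List.length_map]; omega
  have hl : (D.ringEventsAt O e false).length =
      ((D.ringEventsAt O e false).map ringEvent).length := by simp
  rw [hl, List.take_length_add_append, List.take_append_of_le_length hi, ← List.map_take,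
    Surface.jumpSum_append]

/-- Around a ring the tube changes by the sheets of the strand ends that meet at the junction. -/
theorem jumpSum_ring (τ : (D.unbridge O).Surface) (v : {v : D.Junction // v ∉ O}) :
    τ.jumpSum (ringOf v) ((D.unbridge O).events (ringOf v)) =
      ∑ x ∈ D.legs v, τ.sheet (loopOf O x.1) := by
  have hjump : ∀ r : D.RingBraid O, r.1.2 = v →
      τ.jump (ringOf v) (ringEvent r) = τ.sheet (loopOf O r.1.1.1) := fun r hr => by
    have hk : D.kind r.1.1.1 = ((D.junctionKind v).opp).opp := by
      rw [StrandKind.opp_opp, ← hr]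
      exact (D.kind_of_endpoint r.2).symm
    exact congrArg τ.sheet (if_pos hk)
  rw [unbridge_events_ringOf, Surface.jumpSum_map, ringEvents, Finset.sum_map_toList]
  refine Finset.sum_bij (fun r _ => r.1.1) (fun r hr => ?_) (fun r hr s hs h => ?_)
    (fun x hx => ?_) (fun r hr => ?_)
  · rw [Finset.mem_filter] at hr
    exact Finset.mem_filter.2 ⟨Finset.mem_univ _, hr.2 ▸ r.2⟩
  · rw [Finset.mem_filter] at hr hs
    exact Subtype.ext (Prod.ext h (hr.2.trans hs.2.symm))
  · exact ⟨⟨(x, v), (Finset.mem_filter.1 hx).2⟩, by simp, rfl⟩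
  · exact hjump r (Finset.mem_filter.1 hr).2

/-- Measuring against the added segment cancels the free initial tube of a closed strand; what is
left at its start is the jump across the first ring. An original loop meets no rings and keeps its
initial tube. -/
theorem restrict_tube {τ : (D.unbridge O).Surface} (hτ : τ.IsCorrelationSurface) (e : D.Strand)
    (i : Fin ((D.events e).length + 1)) :
    (D.restrict O τ).tube e i = (if D.ends e = none then τ.tube (loopOf O e) 0 else 0) +
      (D.endpoint e false).elim 0 (D.restrict O τ).junctionTube +
        (D.restrict O τ).jumpSum e ((D.events e).take i) := by
  have : (D.restrict O τ).tube e i = τ.tube (loopOf O e)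
      ⟨(D.ringEventsAt O e false).length + i.1, D.segment_lt O e i⟩ +
        if D.ends e = none then 0 else τ.tube (loopOf O e) 0 := rfl
  rw [this, hτ.tube_eq, jumpSum_unbridge_take]
  split_ifs
  · ring
  · linear_combination CharTwo.add_self_eq_zero (τ.tube (loopOf O e) 0)

/-! ### Bridged structures and the correspondence of surfaces. -/

/-- A function on junctions that is constant along strands pairs to zero with the sums of the sheets
at the junctions, since every strand has two ends. -/
theorem sum_mul_sum_legs (s : D.Strand → ZMod 2) (g : D.Junction → ZMod 2)
    (hg : ∀ e u v, D.ends e = some (u, v) → g u = g v) :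
    ∑ v, g v * ∑ x ∈ D.legs v, s x.1 = 0 := by
  have h1 : ∀ v, g v * ∑ x ∈ D.legs v, s x.1 =
      ∑ e, ∑ b, if D.endpoint e b = some v then g v * s e else 0 := fun v => by
    rw [legs, Finset.mul_sum, Finset.sum_filter, Fintype.sum_prod_type]
  simp only [h1]
  rw [Finset.sum_comm]
  refine Finset.sum_eq_zero fun e _ => ?_
  rw [Finset.sum_comm, Fintype.sum_bool]
  rcases he : D.ends e with _ | ⟨u, v⟩
  · simp [endpoint, he]
  · simp [endpoint, he, hg e u v he, CharTwo.add_self_eq_zero]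

theorem SameStructure.symm {u v : D.Junction} (h : D.SameStructure u v) : D.SameStructure v u :=
  Relation.EqvGen.symm _ _ h

theorem SameStructure.trans {u v w : D.Junction} (h : D.SameStructure u v)
    (h' : D.SameStructure v w) : D.SameStructure u w :=
  Relation.EqvGen.trans _ _ _ h h'

theorem SameStructure.of_ends {e : D.Strand} {u v : D.Junction} (h : D.ends e = some (u, v)) :
    D.SameStructure u v :=
  Relation.EqvGen.rel _ _ ⟨e, h⟩

theorem sameStructure_iff_of_ends {e : D.Strand} {u v : D.Junction} (h : D.ends e = some (u, v))
    (o : D.Junction) : D.SameStructure o u ↔ D.SameStructure o v :=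
  ⟨fun h' => h'.trans (.of_ends h), fun h' => h'.trans (SameStructure.of_ends h).symm⟩

/-- If the sheets add up to zero at all junctions outside `O`, then they do so at all junctions. -/
theorem sum_legs_eq_zero (hO : ∀ u ∈ O, ∀ v ∈ O, D.SameStructure u v → u = v)
    (s : D.Strand → ZMod 2) (hs : ∀ v ∉ O, ∑ x ∈ D.legs v, s x.1 = 0) (v : D.Junction) :
    ∑ x ∈ D.legs v, s x.1 = 0 := by
  by_cases hv : v ∈ O
  -- Pairing with the indicator of the structure of `v` leaves only the term at `v`: the other
  -- junctions of the structure lie outside `O`.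
  · have h := sum_mul_sum_legs s (fun u => if D.SameStructure v u then 1 else 0)
      (fun e u w he => by simp only [sameStructure_iff_of_ends he])
    rw [Finset.sum_eq_single v] at h
    · simpa [if_pos (show D.SameStructure v v from Relation.EqvGen.refl v)] using h
    · intro u _ hu
      by_cases huO : u ∈ O
      · rw [if_neg fun h' => hu (hO v hv u huO h').symm, zero_mul]
      · rw [hs u huO, mul_zero]
    · exact fun h => absurd (Finset.mem_univ v) h
  · exact hs v hv

theorem restrict_isCorrelationSurface (hO : ∀ u ∈ O, ∀ v ∈ O, D.SameStructure u v → u = v)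
    {τ : (D.unbridge O).Surface} (hτ : τ.IsCorrelationSurface) :
    (D.restrict O τ).IsCorrelationSurface where
  tube_sheet e i := Surface.tube_sheet_of_tube_eq (restrict_tube hτ e) i
  loop e he := by
    have h := hτ.jumpSum_loop (e := loopOf O e) rfl
    rw [jumpSum_unbridge] at h
    simp only [endpoint, he, Option.map_none, Option.elim_none, zero_add, add_zero] at h
    rw [restrict_tube hτ, restrict_tube hτ]
    simpa using h
  tube_tube e u v he := by
    have h := hτ.jumpSum_loop (e := loopOf O e) rfl
    rw [jumpSum_unbridge] at h
    simp only [endpoint, he, Option.map_some, Option.elim_some, Bool.false_eq_true, if_false,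
      if_true] at h
    rw [restrict_tube hτ, restrict_tube hτ]
    simp only [endpoint, he, Option.map_some, Option.elim_some, Bool.false_eq_true, if_false,
      reduceCtorEq, zero_add, Fin.val_zero, List.take_zero, Fin.val_last, List.take_length]
    refine ⟨by simp, ?_⟩
    -- The closing condition `h` says that the jumps across both rings and along the strand sum to
    -- zero.
    linear_combination h - CharTwo.add_self_eq_zero ((D.restrict O τ).junctionTube v)
  sheet_sheet := sum_legs_eq_zero hO _ fun v hv =>
    (jumpSum_ring τ ⟨v, hv⟩).symm.trans (hτ.jumpSum_loop (e := ringOf ⟨v, hv⟩) rfl)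

theorem restrict_logical (τ : (D.unbridge O).Surface) :
    (D.restrict O τ).logical = τ.logical :=
  rfl

/-- The lift is forced on sheets, ring sheets being junction tubes, which is why these must vanish
where the ring is left out. Its tubes exist because every loop and ring closes up. -/
theorem exists_restrict_eq {σ : D.Surface} (hσ : σ.IsCorrelationSurface)
    (h0 : ∀ v ∈ O, σ.junctionTube v = 0) :
    ∃ τ : (D.unbridge O).Surface, τ.IsCorrelationSurface ∧ D.restrict O τ = σ := by
  let sheet : (D.unbridge O).Strand → ZMod 2 := Sum.elim σ.sheet fun v => σ.junctionTube v.1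
  -- Only original loops need a prescribed initial tube; on closed strands and rings it is a free
  -- choice.
  let start : (D.unbridge O).Strand → ZMod 2 :=
    Sum.elim (fun e => if D.ends e = none then σ.tube e 0 else 0) 0
  let τ : (D.unbridge O).Surface := Surface.ofStart (D.unbridge O) sheet start Empty.elim σ.portTube
  have htube : ∀ e i, τ.tube e i = start e + τ.jumpSum e (((D.unbridge O).events e).take i) :=
    fun _ _ => rfl
  have hsheet : (D.restrict O τ).sheet = σ.sheet := rfl
  have hport : (D.restrict O τ).portTube = σ.portTube := rfl
  have hjunction : (D.restrict O τ).junctionTube = σ.junctionTube := by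
    funext v
    by_cases hv : v ∈ O
    · simp [restrict, hv, h0]
    · simp [restrict, hv, τ, Surface.ofStart, sheet]
  have hjump : (D.restrict O τ).jump = σ.jump := Surface.jump_congr hsheet hport
  have hloop : ∀ e, τ.jumpSum e ((D.unbridge O).events e) = 0 := by
    rintro (e | v)
    · change τ.jumpSum (loopOf O e) ((D.unbridge O).events (loopOf O e)) = 0
      rw [jumpSum_unbridge, hjunction, Surface.jumpSum, hjump]
      rcases he : D.ends e with _ | ⟨u, v⟩
      · simpa [endpoint, he, Surface.jumpSum] using hσ.jumpSum_loop he
      · obtain ⟨h1, h2⟩ := hσ.tube_tube e u v he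
        rw [hσ.tube_eq, Fin.val_last, List.take_length, Surface.jumpSum] at h2
        simp only [endpoint, he, Option.map_some, Option.elim_some, Bool.false_eq_true, if_false,
          if_true]
        rw [← h1, h2]
        exact CharTwo.add_self_eq_zero _
    · change τ.jumpSum (ringOf v) ((D.unbridge O).events (ringOf v)) = 0
      rw [jumpSum_ring]
      exact hσ.sheet_sheet v
  have hτ : τ.IsCorrelationSurface :=
    { tube_sheet := fun e => Surface.tube_sheet_of_tube_eq (fun _ => rfl)
      loop := fun e _ => by
        rw [htube, htube]
        simpa using hloop e
      tube_tube := fun e u => u.elim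
      sheet_sheet := fun v => v.elim }
  refine ⟨τ, hτ, Surface.ext hsheet ?_ hjunction hport⟩
  funext e i
  rw [restrict_tube hτ, hσ.tube_eq, hjunction, Surface.jumpSum, hjump]
  congr 1
  have : τ.tube (loopOf O e) 0 = if D.ends e = none then σ.tube e 0 else 0 := by
    rw [htube]
    simp only [Fin.val_zero, List.take_zero, Surface.jumpSum_nil, add_zero]
    rfl
  rw [this]
  rcases he : D.ends e with _ | ⟨u, v⟩
  · simp [endpoint, he]
  · simpa [endpoint, he] using (hσ.tube_tube e u v he).1.symm

/-- Adding tubes around whole bridged structures, one can remove the tubes at the junctions in `O`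
without changing the logical operators. -/
theorem exists_junctionTube_eq_zero (hO : ∀ u ∈ O, ∀ v ∈ O, D.SameStructure u v → u = v)
    {σ : D.Surface} (hσ : σ.IsCorrelationSurface) :
    ∃ σ' : D.Surface, σ'.IsCorrelationSurface ∧ σ'.logical = σ.logical ∧
      ∀ v ∈ O, σ'.junctionTube v = 0 := by
  -- On the structure of a junction in `O`, `g` is constantly the tube at that junction; on
  -- structures that avoid `O` it is zero.
  let g : D.Junction → ZMod 2 :=
    fun v => ∑ o ∈ O, if D.SameStructure o v then σ.junctionTube o else 0
  have hg : ∀ e u v, D.ends e = some (u, v) → g u = g v := fun e u v he => by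
    simp only [g, sameStructure_iff_of_ends he]
  -- Reading `g` at the start of a strand suffices, as it agrees at the other end; original loops
  -- are left alone.
  refine ⟨⟨σ.sheet, fun e i => σ.tube e i + (D.endpoint e false).elim 0 g,
    fun v => σ.junctionTube v + g v, σ.portTube⟩, ⟨fun e i => ?_, fun e he => ?_,
    fun e u v he => ?_, hσ.sheet_sheet⟩, rfl, fun v hv => ?_⟩
  · simp only [hσ.tube_sheet e i]
    exact add_right_comm _ _ _
  · simp only [hσ.loop e he]
  · have h := hσ.tube_tube e u v he
    simp [endpoint, he, h.1, h.2, hg e u v he]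
  · have : g v = σ.junctionTube v := by
      simp only [g]
      rw [Finset.sum_eq_single v, if_pos (show D.SameStructure v v from Relation.EqvGen.refl v)]
      · intro o ho hov
        exact if_neg fun h => hov (hO o ho v hv h)
      · exact fun h => absurd hv h
    simp only [this]
    exact CharTwo.add_self_eq_zero _

theorem logicalCorrelations_unbridge (hO : ∀ u ∈ O, ∀ v ∈ O, D.SameStructure u v → u = v) :
    (D.unbridge O).logicalCorrelations = D.logicalCorrelations := by
  ext P
  constructor
  · rintro ⟨τ, hτ, rfl⟩
    exact ⟨_, restrict_isCorrelationSurface hO hτ, restrict_logical τ⟩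
  · rintro ⟨σ, hσ, rfl⟩
    obtain ⟨σ', hσ', hl, h0⟩ := exists_junctionTube_eq_zero hO hσ
    obtain ⟨τ, hτ, rfl⟩ := exists_restrict_eq hσ' h0
    exact ⟨τ, hτ, (restrict_logical τ).symm.trans hl⟩

theorem isElementary_unbridge : (D.unbridge O).IsElementary :=
  ⟨inferInstanceAs (IsEmpty Empty), fun _ => rfl⟩

end BraidedDiagram

/-! ### Lattice surgery with `Z ⊗ ⋯ ⊗ Z` measurements -/

theorem mergeProjector_Z {Q : Type} [inst : DecidableEq (Q → ZMod 2)] (S : Finset Q) :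
    mergeProjector (PauliBasis.Z, S) =
      Matrix.diagonal fun a : Q → ZMod 2 => if ∑ p ∈ S, a p = 0 then (1 : ℂ) else 0 := by
  obtain rfl : inst = fun _ _ => Classical.propDecidable _ := Subsingleton.elim _ _
  rw [mergeProjector, ← Matrix.diagonal_one, Matrix.diagonal_add, ← Matrix.diagonal_smul]
  congr 1
  ext a
  simp only [Pi.smul_apply, smul_eq_mul]
  split_ifs <;> norm_num

theorem prod_mergeProjector_Z {Q : Type} [Fintype (Q → ZMod 2)]
    [DecidableEq (Q → ZMod 2)] (l : List (PauliBasis × Finset Q))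
    (hl : ∀ P ∈ l, P.1 = .Z) :
    (l.map mergeProjector).prod =
      Matrix.diagonal fun a : Q → ZMod 2 => if ∀ P ∈ l, ∑ p ∈ P.2, a p = 0 then (1 : ℂ) else 0 := by
  induction l with
  | nil => simp
  | cons P l ih =>
    obtain ⟨B, S⟩ := P
    obtain rfl : B = .Z := hl _ List.mem_cons_self
    rw [List.map_cons, List.prod_cons, ih fun P hP => hl P (List.mem_cons_of_mem _ hP),
      mergeProjector_Z, Matrix.diagonal_mul_diagonal]
    congr 1
    ext a
    simp only [List.forall_mem_cons]
    by_cases h : ∑ p ∈ S, a p = 0 <;> simp [h]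

namespace LSCircuit

variable {In Out : Type} [Fintype In] [Fintype Out]

theorem xAmp_zero (a : ZMod 2) : xAmp 0 a = 1 / (Real.sqrt 2 : ℂ) := by
  simp [xAmp]

/-- A circuit with `Z ⊗ ⋯ ⊗ Z` measurements only, between preparations and measurements in the `X`
basis, counts the bits in the ancilla patches that are compatible with the measurements. -/
theorem computation_eq_sum (L : LSCircuit In Out) (hinit : ∀ q, L.init q = .X)
    (hfinal : ∀ q, L.final q = .X) (hmerges : ∀ P ∈ L.merges, P.1 = .Z) :
    ∃ c : ℂ, c ≠ 0 ∧ ∀ y x, L.computation y x = c * ∑ a : (In ⊕ Out) ⊕ L.Ancilla → ZMod 2,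
      if a ∘ Sum.inl = Sum.elim x y ∧ ∀ P ∈ L.merges, ∑ p ∈ P.2, a p = 0 then 1 else 0 := by
  -- One factor for each prepared output or ancilla and each measured input or ancilla.
  refine ⟨(∏ _o : Out, 1 / (Real.sqrt 2 : ℂ)) * (∏ _c : L.Ancilla, 1 / (Real.sqrt 2 : ℂ)) *
    ((∏ _i : In, 1 / (Real.sqrt 2 : ℂ)) * ∏ _c : L.Ancilla, 1 / (Real.sqrt 2 : ℂ)), by simp,
    fun y x => ?_⟩
  rw [computation, prod_mergeProjector_Z _ fun P hP => hmerges P (List.mem_reverse.1 hP),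
    Matrix.mul_apply, Finset.mul_sum]
  refine Finset.sum_congr rfl fun a _ => ?_
  rw [Matrix.mul_diagonal]
  simp only [finalMatrix, initMatrix, hinit, hfinal, PauliBasis.ket, xAmp_zero, List.mem_reverse]
  have : a ∘ Sum.inl = Sum.elim x y ↔
      (∀ i, a (.inl (.inl i)) = x i) ∧ ∀ o, a (.inl (.inr o)) = y o := by
    rw [funext_iff, Sum.forall]
    rfl
  simp only [this]
  by_cases h1 : ∀ i, a (.inl (.inl i)) = x i <;> by_cases h2 : ∀ o, a (.inl (.inr o)) = y o <;>
    by_cases h3 : ∀ P ∈ L.merges, ∑ p ∈ P.2, a p = 0 <;>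
    simp only [h1, h2, h3, implies_true, and_true, true_and, and_false, false_and, if_true, if_false] <;>
    ring

end LSCircuit

namespace BraidedDiagram

/-! ### Closing conditions in diagrams of loops. -/

section Loops

variable {Port : Type} [Fintype Port]

theorem jumpSum_events {D : BraidedDiagram Port} (σ : D.Surface) (e : D.Strand) :
    σ.jumpSum e (D.events e) =
      (∑ q with D.portStrand q = e, σ.portTube q) +
        ∑ b with D.braidStrand b (D.kind e) = e, σ.sheet (D.braidStrand b (D.kind e).opp) := by
  have h : (D.events e).toFinset = Finset.univ.filter fun x =>
      Sum.elim (fun b => D.braidStrand b (D.kind e) = e) (fun q => D.portStrand q = e) x := by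
    ext (b | q)
    · simp [D.braid_mem_events]
    · simp [D.port_mem_events]
  rw [Surface.jumpSum, ← List.sum_toFinset _ (D.nodup_events e), h, Finset.sum_filter,
    Fintype.sum_sum_type, add_comm, Finset.sum_filter, Finset.sum_filter]
  rfl

/-- In a diagram of loops, the exponents of `X` are determined by the sheets along the dual
loops. -/
theorem IsElementary.mem_xCorrelations_iff {D : BraidedDiagram Port} (hD : D.IsElementary)
    {a : Port → ZMod 2} :
    a ∈ D.xCorrelations ↔ ∃ s : D.Strand → ZMod 2,
      (∀ q, D.kind (D.portStrand q) = .dual → a q = s (D.portStrand q)) ∧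
      ∀ p, D.kind p = .primal → (∑ q with D.portStrand q = p, a q) +
        ∑ b with D.braidStrand b .primal = p, s (D.braidStrand b .dual) = 0 := by
  rw [mem_xCorrelations]
  constructor
  · rintro ⟨σ, hσ, h⟩
    refine ⟨σ.sheet, fun q hq => ?_, fun p hp => ?_⟩
    · rw [← h, σ.logical_fst_of_dual hq]
    · have hl := hσ.jumpSum_loop (hD.2 p)
      rw [jumpSum_events, hp] at hl
      rw [← hl]
      congr 1
      refine Finset.sum_congr rfl fun q hq => ?_
      rw [← h, σ.logical_fst_of_primal ((Finset.mem_filter.1 hq).2 ▸ hp)]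
  · rintro ⟨s, hs, hp⟩
    -- Primal sheets and dual port tubes are set to zero, so dual loops close trivially and only
    -- primal loops impose conditions.
    let σ : D.Surface := Surface.ofStart D (fun e => if D.kind e = .primal then 0 else s e) 0 0
      (fun q => if D.kind (D.portStrand q) = .primal then a q else 0)
    have htube : ∀ e i, σ.tube e i = 0 + σ.jumpSum e ((D.events e).take i) := fun _ _ => rfl
    have hport : ∀ q, σ.portTube q = if D.kind (D.portStrand q) = .primal then a q else 0 :=
      fun _ => rfl
    have hsheet : ∀ e, σ.sheet e = if D.kind e = .primal then 0 else s e := fun _ => rfl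
    refine ⟨σ, ⟨fun e => Surface.tube_sheet_of_tube_eq (htube e), fun e _ => ?_,
      fun e u v h => by simp [hD.2] at h, fun v => hD.1.elim v⟩, fun q => ?_⟩
    · rw [htube, htube, Fin.val_last, List.take_length, jumpSum_events]
      simp only [hport, hsheet, kind_braidStrand, Fin.val_zero, List.take_zero,
        Surface.jumpSum_nil]
      rcases hk : D.kind e with _ | _
      · rw [zero_add, add_zero]
        refine Eq.trans ?_ (hp e hk)
        simp only [StrandKind.opp, reduceCtorEq, if_false]
        congr 1
        refine Finset.sum_congr rfl fun q hq => ?_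
        rw [(Finset.mem_filter.1 hq).2, if_pos hk]
      · rw [Finset.sum_eq_zero fun q hq => ?_]
        · simp [StrandKind.opp]
        · rw [(Finset.mem_filter.1 hq).2, hk]
          simp
    · rcases hk : D.kind (D.portStrand q) with _ | _
      · rw [σ.logical_fst_of_primal hk, hport, if_pos hk]
      · rw [σ.logical_fst_of_dual hk, hsheet, hk, hs q hk]
        simp

end Loops

/-! ### The lattice-surgery circuit of a diagram of loops. -/

variable {In Out : Type} [Fintype In] [Fintype Out]

theorem natCast_eq_ite_odd (n : ℕ) : (n : ZMod 2) = if Odd n then 1 else 0 := by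
  split_ifs with h
  · exact ZMod.natCast_eq_one_iff_odd.2 h
  · exact ZMod.natCast_eq_zero_iff_even.2 (Nat.not_odd_iff_even.1 h)

/-- A dual loop braided `n` times with `p` contributes `n` times its bit, which depends only on the
parity of `n`. The measured parity is thus the total jump along `p`. -/
theorem sum_mergeSet (D : BraidedDiagram (In ⊕ Out)) (p : D.Strand)
    (a : (In ⊕ Out) ⊕ {e : D.Strand // D.kind e = .dual} → ZMod 2) :
    ∑ c ∈ D.mergeSet p, a c = (∑ q with D.portStrand q = p, a (.inl q)) +
      ∑ b with D.braidStrand b .primal = p,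
        a (.inr ⟨D.braidStrand b .dual, D.kind_braidStrand b .dual⟩) := by
  have hl : ∀ q, Sum.inl q ∈ D.mergeSet p ↔ D.portStrand q = p := fun q => by simp [mergeSet]
  have hr : ∀ d : {e : D.Strand // D.kind e = .dual}, Sum.inr d ∈ D.mergeSet p ↔
      Odd (Finset.univ.filter fun b =>
        D.braidStrand b .primal = p ∧ D.braidStrand b .dual = d.1).card := fun d => by
    simp [mergeSet]
  rw [← Finset.univ_inter (D.mergeSet p), ← Finset.sum_ite_mem, Fintype.sum_sum_type]
  simp only [hl, hr]
  rw [Finset.sum_filter]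
  congr 1
  have h : ∀ d : {e : D.Strand // D.kind e = .dual},
      (if Odd (Finset.univ.filter fun b =>
        D.braidStrand b .primal = p ∧ D.braidStrand b .dual = d.1).card then a (.inr d) else 0) =
      ∑ b with D.braidStrand b .primal = p,
        if (⟨D.braidStrand b .dual, D.kind_braidStrand b .dual⟩ :
          {e : D.Strand // D.kind e = .dual}) = d then a (.inr d) else 0 := fun d => by
    rw [← Finset.sum_filter, Finset.sum_const, Finset.filter_filter, nsmul_eq_mul,
      natCast_eq_ite_odd, ite_mul, one_mul, zero_mul]
    simp only [Subtype.ext_iff]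
  refine (Finset.sum_congr rfl fun d _ => Eq.trans (by congr) (h d)).trans ?_
  rw [Finset.sum_comm]
  simp

theorem sum_portSet (D : BraidedDiagram (In ⊕ Out)) {q : In ⊕ Out}
    (hq : D.kind (D.portStrand q) = .dual)
    (a : (In ⊕ Out) ⊕ {e : D.Strand // D.kind e = .dual} → ZMod 2) :
    ∑ c ∈ D.portSet q, a c = a (.inl q) + a (.inr ⟨D.portStrand q, hq⟩) := by
  have : D.portSet q = {.inl q, .inr ⟨D.portStrand q, hq⟩} := by
    ext (q' | d)
    · simp [portSet]
    · simp [portSet, Subtype.ext_iff, eq_comm]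
  rw [this, Finset.sum_pair (by simp)]

theorem toLS_merges_iff (D : BraidedDiagram (In ⊕ Out))
    (a : (In ⊕ Out) ⊕ {e : D.Strand // D.kind e = .dual} → ZMod 2) :
    (∀ P ∈ D.toLS.merges, ∑ c ∈ P.2, a c = 0) ↔
      (∀ p, D.kind p = .primal → ∑ c ∈ D.mergeSet p, a c = 0) ∧
      ∀ q, D.kind (D.portStrand q) = .dual → ∑ c ∈ D.portSet q, a c = 0 := by
  change (∀ P : PauliBasis × Finset ((In ⊕ Out) ⊕ {e : D.Strand // D.kind e = .dual}),
    P ∈ (_ ++ _ : List _) → ∑ c ∈ P.2, a c = 0) ↔ _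
  rw [List.forall_mem_append, List.forall_mem_map, List.forall_mem_map]
  simp

/-- Patch bits and sheets are the same data: the bit of an ancilla is the sheet of its dual loop. -/
theorem IsElementary.exists_patches_iff {D : BraidedDiagram (In ⊕ Out)} (hD : D.IsElementary)
    (z : In ⊕ Out → ZMod 2) :
    (∃ a : (In ⊕ Out) ⊕ D.toLS.Ancilla → ZMod 2, a ∘ Sum.inl = z ∧
      ∀ P ∈ D.toLS.merges, ∑ p ∈ P.2, a p = 0) ↔ z ∈ D.xCorrelations := by
  rw [hD.mem_xCorrelations_iff]
  constructor
  · rintro ⟨a, rfl, ha⟩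
    obtain ⟨hp, hq⟩ := (D.toLS_merges_iff a).1 ha
    -- The value `0` on primal loops is arbitrary: only the sheets of dual loops enter the
    -- conditions.
    refine ⟨fun e => if h : D.kind e = .dual then a (.inr ⟨e, h⟩) else 0, fun q h => ?_,
      fun p h => ?_⟩
    · have := (sum_portSet D h a).symm.trans (hq q h)
      change a (.inl q) = if h : D.kind (D.portStrand q) = .dual then a (.inr ⟨_, h⟩) else 0
      rw [dif_pos h]
      exact CharTwo.add_eq_zero.1 this
    · refine Eq.trans ?_ ((sum_mergeSet D p a).symm.trans (hp p h))
      congr 1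
      exact Finset.sum_congr rfl fun b _ => dif_pos (D.kind_braidStrand b .dual)
  · rintro ⟨s, hs, hp⟩
    refine ⟨Sum.elim z fun d => s d.1, rfl, (D.toLS_merges_iff _).2 ⟨fun p h => ?_, fun q h => ?_⟩⟩
    · exact (sum_mergeSet D p _).trans (hp p h)
    · exact (sum_portSet D h _).trans (CharTwo.add_eq_zero.2 (hs q h))

theorem IsElementary.toLS_computation {D : BraidedDiagram (In ⊕ Out)} (hD : D.IsElementary) :
    ∃ c : ℂ, c ≠ 0 ∧ ∀ y x,
      D.toLS.computation y x = if Sum.elim x y ∈ D.xCorrelations then c else 0 := by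
  obtain ⟨c₁, hc₁, h₁⟩ := D.toLS.computation_eq_sum (fun _ => rfl) (fun _ => rfl) fun P hP => by
    rcases List.mem_append.1 hP with hP | hP <;> obtain ⟨_, _, rfl⟩ := List.mem_map.1 hP <;> rfl
  obtain ⟨c₂, hc₂, h₂⟩ := sum_indicator_fiber
    (fun (z : In ⊕ Out → ZMod 2) (a : (In ⊕ Out) ⊕ D.toLS.Ancilla → ZMod 2) =>
      a ∘ Sum.inl = z ∧ ∀ P ∈ D.toLS.merges, ∑ p ∈ P.2, a p = 0)
    (fun z => funext fun q => CharTwo.add_self_eq_zero (z q)) ⟨rfl, by simp⟩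
    (fun z a z' a' h h' => ⟨by rw [← h.1, ← h'.1]; rfl, fun P hP => by
      simp [Finset.sum_add_distrib, h.2 P hP, h'.2 P hP]⟩)
  refine ⟨c₁ * c₂, mul_ne_zero hc₁ hc₂, fun y x => ?_⟩
  have h := h₂ (Sum.elim x y)
  simp only [hD.exists_patches_iff] at h
  rw [h₁, ← mul_ite_zero, ← h]
  exact congrArg _ (Finset.sum_congr rfl fun a _ => by congr)

end BraidedDiagram


/-! ### Comparison of the linear maps and conclusion. -/

theorem exists_smul_eq_of_indicator {m n : Type} {A B : Matrix m n ℂ}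
    {S : m → n → Prop} {c d : ℂ} (hc : c ≠ 0) (hd : d ≠ 0)
    (hA : ∀ y x, A y x = if S y x then c else 0) (hB : ∀ y x, B y x = if S y x then d else 0) :
    ∃ k : ℂ, k ≠ 0 ∧ A = k • B := by
  refine ⟨c / d, div_ne_zero hc hd, ?_⟩
  ext y x
  rw [Matrix.smul_apply, hA, hB]
  split_ifs <;> simp [hd]

end SurfaceCode

theorem mainTheorem4 {In Out : Type} [Fintype In] [Fintype Out]
    (D : SurfaceCode.BraidedDiagram (In ⊕ Out)) (O : Finset D.Junction)
    (hO : ∀ u ∈ O, ∀ v ∈ O, D.SameStructure u v → u = v) :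
    -- the result consists of independent loops, and its only connections are braids
    (D.unbridge O).IsElementary ∧
    -- the logical computation is unchanged
    (∃ c : ℂ, c ≠ 0 ∧ (D.unbridge O).computation = c • D.computation) ∧
    -- the logical operators at inputs and outputs are correlated as before
    (D.unbridge O).logicalCorrelations = D.logicalCorrelations ∧
    -- the correlation surfaces correspond, with tubes at junctions turned into sheets of rings
    (∀ τ : (D.unbridge O).Surface, τ.IsCorrelationSurface →
      (D.restrict O τ).IsCorrelationSurface) ∧
    (∀ σ : D.Surface, σ.IsCorrelationSurface → (∀ v ∈ O, σ.junctionTube v = 0) →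
      ∃ τ : (D.unbridge O).Surface, τ.IsCorrelationSurface ∧ D.restrict O τ = σ) ∧
    -- the loops perform the computation as a lattice-surgery circuit
    (∃ c : ℂ, c ≠ 0 ∧ (D.unbridge O).toLS.computation = c • D.computation) := by
  have hE : (D.unbridge O).IsElementary := SurfaceCode.BraidedDiagram.isElementary_unbridge
  have hcorr := SurfaceCode.BraidedDiagram.logicalCorrelations_unbridge hO
  -- Equal correlations give all three tensors the same support, on which each is constant.
  have hx : (D.unbridge O).xCorrelations = D.xCorrelations := by
    rw [SurfaceCode.BraidedDiagram.xCorrelations, hcorr]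
    rfl
  obtain ⟨c, hc, h⟩ := D.amplitude_eq
  obtain ⟨c', hc', h'⟩ := (D.unbridge O).amplitude_eq
  obtain ⟨d, hd, hLS⟩ := hE.toLS_computation
  rw [hx] at h'
  rw [hx] at hLS
  exact ⟨hE, SurfaceCode.exists_smul_eq_of_indicator hc' hc (fun _ _ => h' _) fun _ _ => h _, hcorr,
    fun τ hτ => SurfaceCode.BraidedDiagram.restrict_isCorrelationSurface hO hτ,
    fun σ hσ h0 => SurfaceCode.BraidedDiagram.exists_restrict_eq hσ h0,
    SurfaceCode.exists_smul_eq_of_indicator hd hc hLS fun _ _ => h _⟩
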